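/- Let $n\ge 0$ and $k\ge 1$ be integers. Let $R$ be a Hermitian symmetric function on $\mathbb C^n$: $R(z,\overline w)$ is given by an entire function on $\mathbb C^n\times\mathbb C^n$ evaluated at $(z,\overline w)$, and $R(z,\overline w)=\overline{R(w,\overline z)}$ for all $z,w\in\mathbb C^n$. Suppose that $R\in\mathcal P_k$, that is, $$\sum_{i,j=1}^k R(z_i,\overline{z_j})\,a_i\,\overline{a_j}\ \ge\ 0\qquad\text{for all } z_1,\dots,z_k\in\mathbb C^n \text{ and all } a\in\mathbb C^k .$$ Write the Taylor expansion of $R$ at the origin as $R(z,\overline w)=\sum_{\alpha,\beta}c_{\alpha\beta}\,z^\alpha\,\overline w^{\,\beta}$, the sum being over multi-indices $\alpha,\beta\in\mathbb N^n$, and let $N_+(R),N_-(R)\in\{0,1,2,\dots\}\cup\{\infty\}$ be the numbers of positive and of negative eigenvalues, counted with multiplicity, of the (possibly infinite) Hermitian matrix $(c_{\alpha\beta})$ acting on $\ell^2(\mathbb N^n)$. Then either $N_-(R)=0$ or $N_+(R)\ge k+1$. -/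

import Mathlib

noncomputable section

namespace HermPos

open scoped ComplexOrder ComplexConjugate

/-- `ℂⁿ`, as a product of `n` copies of `ℂ`. -/
abbrev Cn (n : ℕ) : Type := Fin n → ℂ

/-- Hermitian symmetric functions on `ℂⁿ`. A function on `ℂⁿ` times its conjugate manifold is
written as a function `R` of two points `z` and `ζ` of `ℂⁿ`, where `ζ` stands for the conjugate of
the second point; `R(z, w̄)` is thus `R z (star w)`, `star` being coordinatewise conjugation. It is
entire in `(z, ζ)` and satisfies `R(z, w̄) = conj R(w, z̄)`. -/
structure IsHermitianSymmetric {n : ℕ} (R : Cn n → Cn n → ℂ) : Prop where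
  holomorphic : Differentiable ℂ (fun p : Cn n × Cn n => R p.1 p.2)
  symm : ∀ z w : Cn n, R z (star w) = conj (R w (star z))

/-- The positivity class `𝒫_N(ℂⁿ)`: Hermitian symmetric functions `R` for which every `N × N`
matrix `R(z_i, z̄_j)` is nonnegative definite. (`0 ≤ x` for complex `x` says that `x` is real and
nonnegative.) For `N = 0` the condition is void, and all Hermitian symmetric functions remain. -/
def posClass (n N : ℕ) : Set (Cn n → Cn n → ℂ) :=
  {R | IsHermitianSymmetric R ∧
    ∀ (z : Fin N → Cn n) (a : Fin N → ℂ),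
      0 ≤ ∑ i, ∑ j, R (z i) (star (z j)) * a i * conj (a j)}

/-- The list of directions in `ℂⁿ × ℂⁿ` of the mixed partial derivative `∂_z^a ∂_ζ^b`: each `z_i`
occurs `a i` times and each `ζ_i` occurs `b i` times. -/
def directions {n : ℕ} (a b : Fin n → ℕ) : List (Cn n × Cn n) :=
  (List.finRange n).flatMap (fun i => List.replicate (a i) (Pi.single i 1, 0)) ++
    (List.finRange n).flatMap (fun i => List.replicate (b i) (0, Pi.single i 1))

/-- The Taylor coefficient `c_{ab} = ∂_z^a ∂_ζ^b R (0, 0) / (a! b!)` of `z^a ζ^b` at the origin,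
where `a` and `b` are multi-indices. -/
def taylorCoeff {n : ℕ} (R : Cn n → Cn n → ℂ) (a b : Fin n → ℕ) : ℂ :=
  iteratedFDeriv ℂ (directions a b).length (fun p : Cn n × Cn n => R p.1 p.2) 0
      (directions a b).get /
    ((∏ i, (a i).factorial : ℕ) * (∏ i, (b i).factorial : ℕ))

/-- The eigenspace in `ℓ²(ι)` of a matrix `c`, indexed by a possibly infinite set `ι`, for the real
number `μ`: the square-summable `v` with `c v = μ v`. -/
def eigenspace {ι : Type} (c : ι → ι → ℂ) (μ : ℝ) : Submodule ℂ (lp (fun _ : ι => ℂ) 2) where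
  carrier := {v | ∀ a, HasSum (fun b => c a b * v b) (μ * v a)}
  zero_mem' := fun a => by simp
  add_mem' := fun {v w} hv hw a => by
    simpa [mul_add] using (hv a).add (hw a)
  smul_mem' := fun r v hv a => by
    simpa [mul_left_comm] using (hv a).mul_left r

/-- The multiplicity of `μ` as an eigenvalue of `c` (`0` if it is none, `⊤` if it is infinite). -/
def eigenvalueMult {ι : Type} (c : ι → ι → ℂ) (μ : ℝ) : ℕ∞ :=
  Cardinal.toENat (Module.rank ℂ (eigenspace c μ))

/-- The number in `ℕ ∪ {∞}` of eigenvalues of `c` in `S`, counted with multiplicity: the sum of the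
multiplicities of all elements of `S`, as the supremum of the finite partial sums. -/
def eigenvalueCount {ι : Type} (c : ι → ι → ℂ) (S : Set ℝ) : ℕ∞ :=
  ⨆ F : Finset S, ∑ μ ∈ F, eigenvalueMult c (μ : ℝ)

/-- `N₊(R)`: the number of positive eigenvalues of the matrix of Taylor coefficients. -/
def Npos {n : ℕ} (R : Cn n → Cn n → ℂ) : ℕ∞ :=
  eigenvalueCount (taylorCoeff R) (Set.Ioi 0)

/-- `N₋(R)`: the number of negative eigenvalues of the matrix of Taylor coefficients. -/
def Nneg {n : ℕ} (R : Cn n → Cn n → ℂ) : ℕ∞ :=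
  eigenvalueCount (taylorCoeff R) (Set.Iio 0)

end HermPos

end

/-!
The matrix `c` of Taylor coefficients of `R` is absolutely summable, so it is a compact self-adjoint
operator `T` on `ℓ²`, and its eigenvectors for nonzero eigenvalues are coefficient sequences of
entire functions. Suppose that `T` has a unit eigenvector `u` with eigenvalue `μ < 0`, and that its
positive eigenspaces span a space `V` of dimension at most `k`, with orthonormal basis `v_l`. Since
`T` is negative semidefinite on the orthogonal complement of `V`,
`⟪x, T x⟫ ≤ ‖T‖ ∑ |⟪v_l, x⟫|² + μ |⟪u, x⟫|²` for all `x` (`re_inner_le`).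

Applied to combinations of point evaluations at `k` points, where the form of `T` is the form of `R`
and hence nonnegative, this says that `(‖T‖ / |μ|) ∑ f_l(z) conj f_l(w) - g(z) conj g(w)` is a
positive kernel on any `k` points, `f_l` and `g` being the entire functions with coefficients `v_l`
and `u` (`kernel_bound`). As there are at most `k` functions `f_l`, this forces `g` into their span
(`exists_eq_sum_of_kernel_bound`). To see this, let `F = (f_l)` and choose points `p_j` for which the
`F(p_j)` are a basis of the span of all values, so that `F(z) = ∑ b_j(z) F(p_j)`. If there are fewer
than `k` of them, positivity at `z` and all `p_j` gives `g(z) = ∑ b_j(z) g(p_j)`. If there are `k`,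
positivity at `z` and the `p_j` with `j ≠ 0` gives
`|g(z) - ∑_{j ≠ 0} b_j(z) g(p_j)| ≤ D |b_0(z)|`, and the left side is a constant multiple of `b_0` by
Liouville's theorem. Comparing coefficients, `u` lies in `V`, to which it is orthogonal: a
contradiction.

The expansion of `R` in its Taylor series (`hasSum_taylorCoeff`) is proved from Cauchy's integral
formula in one variable at a time, and coefficients are unique because on the torus they are Fourier
coefficients (`eq_zero_of_hasSum_mono`).
-/

noncomputable section

namespace HermPos

open scoped ComplexOrder ComplexConjugate ContDiff InnerProductSpace
open Metric MeasureTheory Set Filter Topology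

/-! ### Smoothness of entire functions of several variables -/

section Derivatives
variable {E : Type*} [NormedAddCommGroup E] [NormedSpace ℂ E]

lemma differentiable_comp_line {F : E → ℂ} (hF : Differentiable ℂ F) (z v : E) :
    Differentiable ℂ fun t : ℂ => F (z + t • v) := by
  fun_prop

lemma deriv_comp_line {F : E → ℂ} (hF : Differentiable ℂ F) (z v : E) (t : ℂ) :
    deriv (fun t : ℂ => F (z + t • v)) t = fderiv ℂ F (z + t • v) v := by
  have h1 : HasDerivAt (fun t : ℂ => z + t • v) v t := by
    simpa using ((hasDerivAt_id t).smul_const v).const_add z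
  exact ((hF _).hasFDerivAt.comp_hasDerivAt t h1).deriv

/-- Cauchy's estimate for the Fréchet derivative. -/
lemma norm_fderiv_le_of_bound {F : E → ℂ} (hF : Differentiable ℂ F) {x : E} {M : ℝ}
    (hM : ∀ y ∈ closedBall x 1, ‖F y‖ ≤ M) : ‖fderiv ℂ F x‖ ≤ M := by
  have hM0 : 0 ≤ M := (norm_nonneg _).trans (hM x (by simp))
  refine ContinuousLinearMap.opNorm_le_bound _ hM0 fun v => ?_
  rcases eq_or_ne v 0 with rfl | hv
  · simp
  have hv' : 0 < ‖v‖ := norm_pos_iff.2 hv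
  have h := Complex.norm_deriv_le_of_forall_mem_sphere_norm_le (c := 0) (R := ‖v‖⁻¹) (C := M)
    (f := fun t : ℂ => F (x + t • v)) (by positivity)
    ((differentiable_comp_line hF x v).diffContOnCl) (fun t ht => hM _ (by
      simp only [mem_sphere_iff_norm, sub_zero] at ht
      simp [norm_smul, ht, hv'.ne']))
  rw [deriv_comp_line hF] at h
  simpa using h

section Smooth
variable [FiniteDimensional ℂ E]

/-- A directional derivative of an entire function is entire: it is a Cauchy integral over the unit
circle in the given direction, which may be differentiated under the integral sign. -/
lemma differentiable_fderiv_apply {F : E → ℂ} (hF : Differentiable ℂ F) (v : E) :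
    Differentiable ℂ fun x => fderiv ℂ F x v := by
  have : ProperSpace E := FiniteDimensional.proper ℂ E
  let _ : MeasurableSpace E := borel E
  have : BorelSpace E := ⟨rfl⟩
  intro x₀
  have hformula : ∀ x, fderiv ℂ F x v = ∫ θ in (0:ℝ)..2 * Real.pi,
      ((2 * Real.pi * Complex.I)⁻¹ * deriv (circleMap 0 1) θ *
        ((circleMap 0 1 θ) ^ 2)⁻¹) * F (x + circleMap 0 1 θ • v) := by
    intro x
    have h := Complex.two_pi_I_inv_smul_circleIntegral_sub_sq_inv_smul_of_differentiable
      (U := univ) (c := 0) (w₀ := 0) (R := 1) isOpen_univ (subset_univ _)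
      (differentiable_comp_line hF x v).differentiableOn (by simp)
    rw [deriv_comp_line hF] at h
    simp only [zero_smul, add_zero] at h
    rw [← h, circleIntegral, ← intervalIntegral.integral_smul]
    refine intervalIntegral.integral_congr fun θ _ => ?_
    simp only [smul_eq_mul, sub_zero]
    ring
  -- `x` varies by `1`, the circle has radius `‖v‖`, and the Cauchy estimate needs another `1`.
  obtain ⟨M, hM⟩ := (isCompact_closedBall x₀ (1 + ‖v‖ + 1)).exists_bound_of_continuousOn
    hF.continuous.continuousOn
  set w : ℝ → ℂ := fun θ => (2 * Real.pi * Complex.I)⁻¹ * deriv (circleMap 0 1) θ *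
        ((circleMap 0 1 θ) ^ 2)⁻¹ with hw
  have hwc : Continuous w := by
    have h2 : Continuous fun θ : ℝ => circleMap 0 1 θ := continuous_circleMap 0 1
    simp only [hw, deriv_circleMap]
    refine (by fun_prop : Continuous _).mul (Continuous.inv₀ (by fun_prop) fun θ => ?_)
    simp [circleMap]
  have hcirc : Continuous fun θ : ℝ => circleMap 0 1 θ := continuous_circleMap 0 1
  have hint : ∀ x, Continuous fun θ => w θ * F (x + circleMap 0 1 θ • v) := fun x =>
    hwc.mul (hF.continuous.comp (by fun_prop))
  have key := intervalIntegral.hasFDerivAt_integral_of_dominated_of_fderiv_le (μ := volume)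
    (𝕜 := ℂ) (F := fun x θ => w θ * F (x + circleMap 0 1 θ • v))
    (F' := fun x θ => w θ • fderiv ℂ F (x + circleMap 0 1 θ • v))
    (bound := fun θ => ‖w θ‖ * M) (a := 0) (b := 2 * Real.pi) (x₀ := x₀) (s := ball x₀ 1)
    (ball_mem_nhds _ one_pos)
    (Eventually.of_forall fun x => (hint x).aestronglyMeasurable)
    ((hint x₀).intervalIntegrable _ _)
    (by
      refine hwc.aestronglyMeasurable.smul ?_
      refine Measurable.aestronglyMeasurable ?_
      exact (measurable_fderiv ℂ F).comp (by fun_prop : Continuous _).measurable)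
    (Eventually.of_forall fun θ _ x hx => by
      rw [norm_smul]
      gcongr
      refine norm_fderiv_le_of_bound hF fun y hy => hM y ?_
      rw [mem_closedBall, dist_eq_norm] at hy ⊢
      rw [mem_ball, dist_eq_norm] at hx
      have h3 : y - x₀ = (y - (x + circleMap 0 1 θ • v)) + (x - x₀) + circleMap 0 1 θ • v := by
        abel
      have h4 : ‖circleMap 0 1 θ • v‖ = ‖v‖ := by simp [norm_smul]
      rw [h3]
      refine (norm_add₃_le).trans ?_
      rw [h4]; linarith)
    ((hwc.norm.mul continuous_const).intervalIntegrable _ _)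
    (Eventually.of_forall fun θ _ x _ => by
      have h5 : HasFDerivAt (fun x => F (x + circleMap 0 1 θ • v))
          (fderiv ℂ F (x + circleMap 0 1 θ • v)) x := by
        have := (hF (x + circleMap 0 1 θ • v)).hasFDerivAt.comp x
          ((hasFDerivAt_id x).add_const (circleMap 0 1 θ • v))
        rw [ContinuousLinearMap.comp_id] at this
        exact this
      exact h5.const_mul (w θ))
  have := key.differentiableAt
  simp only [funext hformula]
  exact this

theorem contDiff_of_differentiable {F : E → ℂ} (hF : Differentiable ℂ F) : ContDiff ℂ ∞ F := by
  rw [contDiff_infty]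
  intro m
  induction m generalizing F with
  | zero => exact contDiff_zero.2 hF.continuous
  | succ m ih =>
    rw [Nat.cast_succ, contDiff_succ_iff_fderiv_apply]
    exact ⟨hF, by simp, fun v => ih (differentiable_fderiv_apply hF v)⟩

end Smooth

/-! ### Iterated directional derivatives -/

/-- The iterated directional derivative of `F` along the vectors of the list `L`; the head of the
list is the derivative taken last. -/
def dirDeriv (L : List E) (F : E → ℂ) : E → ℂ :=
  L.foldr (fun v G x => fderiv ℂ G x v) F

lemma dirDeriv_append (L L' : List E) (F : E → ℂ) :
    dirDeriv (L ++ L') F = dirDeriv L (dirDeriv L' F) := by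
  simp [dirDeriv]

section FiniteDim
variable [FiniteDimensional ℂ E]

lemma differentiable_dirDeriv {F : E → ℂ} (hF : Differentiable ℂ F) (L : List E) :
    Differentiable ℂ (dirDeriv L F) := by
  induction L with
  | nil => exact hF
  | cons v L ih => exact differentiable_fderiv_apply ih v

lemma iteratedFDeriv_list {F : E → ℂ} (hF : Differentiable ℂ F) (L : List E) (x : E) :
    iteratedFDeriv ℂ L.length F x L.get = dirDeriv L F x := by
  induction L generalizing x with
  | nil => simp [dirDeriv]
  | cons v L ih =>
    have hd : DifferentiableAt ℂ (iteratedFDeriv ℂ L.length F) x :=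
      (contDiff_of_differentiable hF).contDiffAt.differentiableAt_iteratedFDeriv
        (by exact_mod_cast ENat.natCast_lt_top _)
    have h := iteratedFDeriv_succ_apply_left (𝕜 := ℂ) (f := F) (x := x) (n := L.length)
      (v :: L).get
    refine h.trans ?_
    have h2 : (fun y => iteratedFDeriv ℂ L.length F y L.get) = dirDeriv L F := funext ih
    have h3 : dirDeriv (v :: L) F x = fderiv ℂ (dirDeriv L F) x v := rfl
    rw [h3, ← h2]
    have h4 := (hd.hasFDerivAt.continuousMultilinear_apply_const L.get).fderiv
    rw [h4]
    rfl

lemma iteratedDeriv_comp_line {F : E → ℂ} (hF : Differentiable ℂ F) (z v : E) (m : ℕ) :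
    iteratedDeriv m (fun t : ℂ => F (z + t • v)) =
      fun t => dirDeriv (List.replicate m v) F (z + t • v) := by
  induction m with
  | zero => simp [dirDeriv]
  | succ m ih =>
    rw [iteratedDeriv_succ, ih]
    funext t
    exact deriv_comp_line (differentiable_dirDeriv hF _) z v t

/-- The list of the vectors `e i`, each repeated `γ i` times. -/
def multiDir {α : Type*} {n : ℕ} (e : Fin n → α) (γ : Fin n → ℕ) : List α :=
  (List.finRange n).flatMap fun i => List.replicate (γ i) (e i)

lemma multiDir_cons {α : Type*} {n : ℕ} (e : Fin (n + 1) → α) (m : ℕ) (γ : Fin n → ℕ) :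
    multiDir e (Fin.cons m γ : Fin (n + 1) → ℕ) =
      List.replicate m (e 0) ++ multiDir (fun i => e i.succ) γ := by
  simp [multiDir, List.finRange_succ, List.flatMap_map]

/-- Cauchy's estimate on a polydisc spanned by the vectors `e i`. -/
lemma norm_dirDeriv_multiDir_le {n : ℕ} {F : E → ℂ} (hF : Differentiable ℂ F) (e : Fin n → E)
    (z : E) {r M : ℝ} (hr : 0 < r)
    (hM : ∀ s : Fin n → ℂ, (∀ i, ‖s i‖ ≤ r) → ‖F (z + ∑ i, s i • e i)‖ ≤ M) (γ : Fin n → ℕ) :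
    ‖dirDeriv (multiDir e γ) F z‖ ≤ (∏ i, ((γ i).factorial : ℝ)) * M / ∏ i, r ^ γ i := by
  induction n generalizing z with
  | zero => simpa [multiDir, dirDeriv] using hM 0 (by simp)
  | succ n ih =>
    obtain ⟨m, γ, rfl⟩ : ∃ m γ', γ = Fin.cons m γ' := ⟨γ 0, Fin.tail γ, by simp⟩
    rw [multiDir_cons, dirDeriv_append]
    set G := dirDeriv (multiDir (fun i => e i.succ) γ) F with hG
    have hGd : Differentiable ℂ G := differentiable_dirDeriv hF _
    have h1 : ∀ t ∈ sphere (0 : ℂ) r, ‖G (z + t • e 0)‖ ≤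
        (∏ i, ((γ i).factorial : ℝ)) * M / ∏ i, r ^ γ i := by
      intro t ht
      refine ih (fun i => e i.succ) _ (fun s hs => ?_) γ
      have := hM (Fin.cons t s) (fun i => by
        refine Fin.cases ?_ (fun i => ?_) i
        · simpa using ht.le
        · simpa using hs i)
      simpa [Fin.sum_univ_succ, add_assoc] using this
    have h2 := Complex.norm_iteratedDeriv_le_of_forall_mem_sphere_norm_le (c := 0) m hr
      ((differentiable_comp_line hGd z (e 0)).diffContOnCl) h1
    rw [iteratedDeriv_comp_line hGd] at h2
    simp only [zero_smul, add_zero] at h2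
    refine h2.trans (le_of_eq ?_)
    simp only [Fin.prod_univ_succ, Fin.cons_zero, Fin.cons_succ]
    field_simp

end FiniteDim

end Derivatives

/-! ### Taylor series in several variables -/

/-- The monomial `z^γ`. -/
def mono {A : Type*} [CommMonoid A] {n : ℕ} (z : Fin n → A) (γ : Fin n → ℕ) : A := ∏ i, z i ^ γ i

lemma mono_cons {A : Type*} [CommMonoid A] {n : ℕ} (z : Fin (n + 1) → A) (m : ℕ) (γ : Fin n → ℕ) :
    mono z (Fin.cons m γ : Fin (n + 1) → ℕ) = z 0 ^ m * mono (fun i => z i.succ) γ := by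
  simp [mono, Fin.prod_univ_succ]

lemma norm_mono {n : ℕ} (z : Fin n → ℂ) (γ : Fin n → ℕ) :
    ‖mono z γ‖ = mono (fun i => ‖z i‖) γ := by
  simp [mono]

lemma summable_mono {n : ℕ} {x : Fin n → ℝ} (h0 : ∀ i, 0 ≤ x i) (h1 : ∀ i, x i < 1) :
    Summable (mono x) := by
  induction n with
  | zero => exact (hasSum_fintype _).summable
  | succ n ih =>
    rw [← (Fin.consEquiv fun _ : Fin (n + 1) => ℕ).summable_iff]
    have := (summable_geometric_of_lt_one (h0 0) (h1 0)).mul_of_nonneg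
      (ih (x := fun i => x i.succ) (fun i => h0 _) (fun i => h1 _))
      (fun m => pow_nonneg (h0 0) m) (fun γ => Finset.prod_nonneg fun i _ => pow_nonneg (h0 _) _)
    refine this.congr fun p => ?_
    simp [Fin.consEquiv, mono_cons]

section Taylor
variable {E : Type*} [NormedAddCommGroup E] [NormedSpace ℂ E]

/-- The multi-index factorial `γ!`. -/
def mfact {n : ℕ} (γ : Fin n → ℕ) : ℕ := ∏ i, (γ i).factorial

lemma mfact_pos {n : ℕ} (γ : Fin n → ℕ) : 0 < mfact γ :=
  Finset.prod_pos fun _ _ => Nat.factorial_pos _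

lemma exists_bound_polydisc {n : ℕ} {F : E → ℂ} (hF : Differentiable ℂ F) (e : Fin n → E) (z : E)
    (r : ℝ) : ∃ M, ∀ s : Fin n → ℂ, (∀ i, ‖s i‖ ≤ r) → ‖F (z + ∑ i, s i • e i)‖ ≤ M := by
  have hK : IsCompact (univ.pi fun _ : Fin n => closedBall (0 : ℂ) r) :=
    isCompact_univ_pi fun _ => isCompact_closedBall 0 r
  have hc : Continuous fun s : Fin n → ℂ => F (z + ∑ i, s i • e i) :=
    hF.continuous.comp (by fun_prop)
  obtain ⟨M, hM⟩ := hK.exists_bound_of_continuousOn hc.continuousOn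
  exact ⟨M, fun s hs => hM s fun i _ => by simpa using hs i⟩

variable [FiniteDimensional ℂ E]

lemma norm_dirDeriv_div_mul_le {n : ℕ} {F : E → ℂ} (hF : Differentiable ℂ F) (e : Fin n → E)
    (z : E) {r M : ℝ} (hr : 0 < r)
    (hM : ∀ s : Fin n → ℂ, (∀ i, ‖s i‖ ≤ r) → ‖F (z + ∑ i, s i • e i)‖ ≤ M) (t : Fin n → ℂ)
    (γ : Fin n → ℕ) :
    ‖dirDeriv (multiDir e γ) F z / mfact γ * mono t γ‖ ≤ M * mono (fun i => ‖t i‖ / r) γ := by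
  have h := norm_dirDeriv_multiDir_le hF e z hr hM γ
  have h3 : (0 : ℝ) < mfact γ := by exact_mod_cast mfact_pos γ
  have h4 : (∏ i, ((γ i).factorial : ℝ)) = mfact γ := by simp [mfact]
  rw [h4] at h
  have h5 : mono (fun i => ‖t i‖ / r) γ = mono (fun i => ‖t i‖) γ / ∏ i, r ^ γ i := by
    simp [mono, div_pow, Finset.prod_div_distrib]
  rw [norm_mul, norm_div, norm_mono, h5, Complex.norm_natCast]
  have h6 : 0 ≤ mono (fun i => ‖t i‖) γ := by rw [← norm_mono]; positivity
  calc ‖dirDeriv (multiDir e γ) F z‖ / mfact γ * mono (fun i => ‖t i‖) γ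
      ≤ (mfact γ * M / ∏ i, r ^ γ i) / mfact γ * mono (fun i => ‖t i‖) γ := by gcongr
    _ = _ := by field_simp

lemma summable_mono_div {n : ℕ} (t : Fin n → ℂ) :
    Summable (mono (fun i => ‖t i‖ / (‖t‖ + 1))) := by
  refine summable_mono (fun i => by positivity) fun i => ?_
  rw [div_lt_one (by positivity)]
  exact (norm_le_pi_norm t i).trans_lt (lt_add_one _)

/-- Taylor expansion of an entire function in several directions. -/
theorem hasSum_dirDeriv {n : ℕ} {F : E → ℂ} (hF : Differentiable ℂ F) (e : Fin n → E) (z : E)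
    (t : Fin n → ℂ) :
    HasSum (fun γ => dirDeriv (multiDir e γ) F z / mfact γ * mono t γ)
      (F (z + ∑ i, t i • e i)) := by
  induction n generalizing z with
  | zero =>
    simp [multiDir, dirDeriv, mfact, mono]
  | succ n ih =>
    have hs : Summable (fun γ => dirDeriv (multiDir e γ) F z / mfact γ * mono t γ) := by
      obtain ⟨M, hM⟩ := exists_bound_polydisc hF e z (‖t‖ + 1)
      exact Summable.of_norm_bounded ((summable_mono_div t).mul_left M)
        (norm_dirDeriv_div_mul_le hF e z (by positivity) hM t)
    -- Once the family is summable, its sum may be computed iteratively.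
    obtain ⟨S, hS⟩ := hs
    have h1 := ((Equiv.prodComm _ _).trans (Fin.consEquiv fun _ : Fin (n + 1) => ℕ)).hasSum_iff.2 hS
    have h2 : ∀ γ : Fin n → ℕ, HasSum (fun m =>
        ((fun γ => dirDeriv (multiDir e γ) F z / mfact γ * mono t γ) ∘
          ((Equiv.prodComm _ _).trans (Fin.consEquiv fun _ : Fin (n + 1) => ℕ))) (γ, m))
        (dirDeriv (multiDir (fun i => e i.succ) γ) F (z + t 0 • e 0) / mfact γ *
          mono (fun i => t i.succ) γ) := by
      intro γ
      have hG := differentiable_dirDeriv hF (multiDir (fun i => e i.succ) γ)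
      have h3 := Complex.hasSum_taylorSeries_on_ball (c := 0) (r := ‖t 0‖ + 1)
        (differentiable_comp_line hG z (e 0)).differentiableOn (z := t 0) (by simp)
      simp only [iteratedDeriv_comp_line hG, sub_zero, zero_smul, add_zero] at h3
      refine ((h3.div_const (mfact γ : ℂ)).mul_right (mono (fun i => t i.succ) γ)).congr_fun ?_
      intro m
      simp only [Function.comp, Equiv.trans_apply, Equiv.prodComm_apply, Prod.swap_prod_mk,
        Fin.consEquiv, Equiv.coe_fn_mk, multiDir_cons, dirDeriv_append, mono_cons, mfact,
        Fin.prod_univ_succ, Fin.cons_zero, Fin.cons_succ, smul_eq_mul]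
      push_cast
      field_simp
    have h4 := h1.prod_fiberwise h2
    have h5 := ih (fun i => e i.succ) (z + t 0 • e 0) (fun i => t i.succ)
    rw [Fin.sum_univ_succ, ← add_assoc, ← h4.unique h5]
    exact hS

/-- Taylor expansion of an entire function in two families of directions. -/
theorem hasSum_dirDeriv_append {n m : ℕ} {F : E → ℂ} (hF : Differentiable ℂ F) (e : Fin n → E)
    (e' : Fin m → E) (z : E) (t : Fin n → ℂ) (s : Fin m → ℂ) :
    HasSum (fun p : (Fin n → ℕ) × (Fin m → ℕ) =>
      dirDeriv (multiDir e p.1 ++ multiDir e' p.2) F z / (mfact p.1 * mfact p.2) *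
        (mono t p.1 * mono s p.2)) (F (z + ∑ i, t i • e i + ∑ i, s i • e' i)) := by
  have hs : Summable (fun p : (Fin n → ℕ) × (Fin m → ℕ) =>
      dirDeriv (multiDir e p.1 ++ multiDir e' p.2) F z / (mfact p.1 * mfact p.2) *
        (mono t p.1 * mono s p.2)) := by
    obtain ⟨M, hM⟩ := exists_bound_polydisc hF (Fin.append e e') z (max (‖t‖ + 1) (‖s‖ + 1))
    have hM' : ∀ x : Fin n → ℂ, (∀ i, ‖x i‖ ≤ ‖t‖ + 1) → ∀ y : Fin m → ℂ,
        (∀ i, ‖y i‖ ≤ ‖s‖ + 1) → ‖F (z + ∑ i, x i • e i + ∑ i, y i • e' i)‖ ≤ M := by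
      intro x hx y hy
      have := hM (Fin.append x y) (fun i => by
        refine Fin.addCases (fun i => ?_) (fun i => ?_) i
        · simpa using Or.inl (hx i)
        · simpa using Or.inr (hy i))
      simpa [Fin.sum_univ_add, add_assoc] using this
    have hsum := ((summable_mono_div t).mul_of_nonneg (summable_mono_div s)
      (fun γ => Finset.prod_nonneg fun i _ => by positivity)
      (fun γ => Finset.prod_nonneg fun i _ => by positivity)).mul_left M
    refine Summable.of_norm_bounded hsum fun p => ?_
    have h1 := norm_dirDeriv_div_mul_le (differentiable_dirDeriv hF (multiDir e' p.2)) e z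
      (r := ‖t‖ + 1) (by positivity)
      (fun x hx => norm_dirDeriv_multiDir_le hF e' _ (r := ‖s‖ + 1) (by positivity)
        (hM' x hx) p.2) t p.1
    have h3 : (0 : ℝ) < mfact p.2 := by exact_mod_cast mfact_pos p.2
    have h4 : (∏ i, ((p.2 i).factorial : ℝ)) = mfact p.2 := by simp [mfact]
    have h5 : mono (fun i => ‖s i‖ / (‖s‖ + 1)) p.2 =
        mono (fun i => ‖s i‖) p.2 / ∏ i, (‖s‖ + 1) ^ p.2 i := by
      simp [mono, div_pow, Finset.prod_div_distrib]
    rw [h4] at h1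
    rw [dirDeriv_append, h5]
    calc _ = ‖dirDeriv (multiDir e p.1) (dirDeriv (multiDir e' p.2) F) z / mfact p.1 *
          mono t p.1‖ * (‖mono s p.2‖ / mfact p.2) := by
          simp only [norm_mul, norm_div, Complex.norm_natCast]
          field_simp
      _ ≤ _ := mul_le_mul_of_nonneg_right h1 (by positivity)
      _ = _ := by
          rw [norm_mono]
          field_simp
  obtain ⟨S, hS⟩ := hs
  have h1 := (Equiv.prodComm (Fin m → ℕ) (Fin n → ℕ)).hasSum_iff.2 hS
  have h2 : ∀ b : Fin m → ℕ, HasSum (fun a => ((fun p : (Fin n → ℕ) × (Fin m → ℕ) =>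
      dirDeriv (multiDir e p.1 ++ multiDir e' p.2) F z / (mfact p.1 * mfact p.2) *
        (mono t p.1 * mono s p.2)) ∘ (Equiv.prodComm (Fin m → ℕ) (Fin n → ℕ))) (b, a))
      (dirDeriv (multiDir e' b) F (z + ∑ i, t i • e i) / mfact b * mono s b) := by
    intro b
    have h3 := hasSum_dirDeriv (differentiable_dirDeriv hF (multiDir e' b)) e z t
    refine ((h3.div_const (mfact b : ℂ)).mul_right (mono s b)).congr_fun ?_
    intro a
    simp only [Function.comp, Equiv.prodComm_apply, Prod.swap_prod_mk, dirDeriv_append]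
    field_simp
  rw [(hasSum_dirDeriv hF e' (z + ∑ i, t i • e i) s).unique (h1.prod_fiberwise h2)]
  exact hS

end Taylor

/-- An entire function on `ℂⁿ × ℂⁿ` is the sum of its Taylor series at the origin. -/
theorem hasSum_taylorCoeff {n : ℕ} {R : Cn n → Cn n → ℂ}
    (hR : Differentiable ℂ fun p : Cn n × Cn n => R p.1 p.2) (z ζ : Cn n) :
    HasSum (fun p : (Fin n → ℕ) × (Fin n → ℕ) =>
      taylorCoeff R p.1 p.2 * (mono z p.1 * mono ζ p.2)) (R z ζ) := by
  have h := hasSum_dirDeriv_append hR (fun i => (Pi.single i 1, 0)) (fun i => (0, Pi.single i 1))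
    0 z ζ
  have h1 : (0 : Cn n × Cn n) + ∑ i, z i • ((Pi.single i 1, 0) : Cn n × Cn n) +
      ∑ i, ζ i • ((0, Pi.single i 1) : Cn n × Cn n) = (z, ζ) := by
    ext j <;> simp [Finset.sum_apply, Pi.single_apply, Prod.fst_sum, Prod.snd_sum]
  rw [h1] at h
  refine h.congr_fun fun p => ?_
  rw [taylorCoeff, iteratedFDeriv_list hR]
  simp only [mfact, directions, multiDir]

/-! ### Uniqueness of coefficients -/

section Uniqueness
open UnitAddTorus

/-- The coefficients of an everywhere convergent power series that vanishes identically are zero: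
on the unit torus they are Fourier coefficients. -/
theorem eq_zero_of_hasSum_mono {n : ℕ} {v : (Fin n → ℕ) → ℂ}
    (h : ∀ z, HasSum (fun a => v a * mono z a) 0) : v = 0 := by
  have hsum : Summable fun a => ‖v a‖ := by
    simpa [mono] using (h 1).summable.norm
  have hexp : ∀ a : Fin n → ℕ, ∀ x : UnitAddTorus (Fin n),
      mFourier (fun i => (a i : ℤ)) x = mono (fun i => (AddCircle.toCircle (x i) : ℂ)) a := by
    intro a x
    simp [mFourier, mono, fourier_apply, AddCircle.toCircle_nsmul]
  have hL : HasSum (fun a : Fin n → ℕ => v a • mFourierLp (d := Fin n) 2 fun i => (a i : ℤ)) 0 := by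
    have hs : Summable fun a : Fin n → ℕ => v a • mFourier (d := Fin n) fun i => (a i : ℤ) := by
      refine Summable.of_norm_bounded hsum fun a => ?_
      rw [norm_smul, mFourier_norm, mul_one]
    obtain ⟨S, hS⟩ := hs
    have hS0 : S = 0 := by
      ext x
      have h1 := (ContinuousMap.evalCLM ℂ x).hasSum hS
      refine h1.unique ((h fun i => (AddCircle.toCircle (x i) : ℂ)).congr_fun fun a => ?_)
      simp [hexp]
    rw [hS0] at hS
    -- `mFourierLp` is taken with respect to the normalised Haar measure of the circle.
    let _ : MeasureSpace UnitAddCircle := ⟨AddCircle.haarAddCircle⟩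
    have : IsProbabilityMeasure (volume : Measure UnitAddCircle) :=
      inferInstanceAs (IsProbabilityMeasure AddCircle.haarAddCircle)
    simpa [mFourierLp] using
      (ContinuousMap.toLp (E := ℂ) 2 (volume : Measure (UnitAddTorus (Fin n))) ℂ).hasSum hS
  funext b
  have h2 := (innerSL ℂ (mFourierLp (d := Fin n) 2 fun i => (b i : ℤ))).hasSum hL
  have h3 := hasSum_single (f := fun a : Fin n → ℕ =>
      innerSL ℂ (mFourierLp (d := Fin n) 2 fun i => (b i : ℤ))
        (v a • mFourierLp (d := Fin n) 2 fun i => (a i : ℤ))) b fun a hab => by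
    have : (fun i => (b i : ℤ)) ≠ fun i => (a i : ℤ) := fun hh => hab (by
      funext i; exact_mod_cast (congrFun hh i).symm)
    simp [orthonormal_iff_ite.1 orthonormal_mFourier, this]
  have h4 := h3.unique (by simpa using h2)
  rw [innerSL_apply_apply, inner_smul_right, orthonormal_iff_ite.1 orthonormal_mFourier,
    if_pos rfl, mul_one] at h4
  exact h4

end Uniqueness

/-! ### Entire functions dominated by finitely many others -/

/-- Liouville's theorem for quotients: an entire function dominated by a multiple of another one is
a constant multiple of it. -/
theorem mul_eq_mul_of_norm_le {f g : ℂ → ℂ} (hf : Differentiable ℂ f) (hg : Differentiable ℂ g)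
    {C : ℝ} (hC : ∀ t, ‖g t‖ ≤ C * ‖f t‖) {t₀ : ℂ} (h0 : f t₀ ≠ 0) (t : ℂ) :
    g t * f t₀ = g t₀ * f t := by
  have hne : ∀ c, ∀ᶠ z in 𝓝[≠] c, f z ≠ 0 := by
    intro c
    rcases (hf.analyticAt c).eventually_eq_zero_or_eventually_ne_zero with h | h
    · have := AnalyticOnNhd.eq_of_eventuallyEq (f := f) (g := 0) (fun z _ => hf.analyticAt z)
        (fun z _ => analyticAt_const) (z₀ := c) h
      exact absurd (congrFun this t₀) h0
    · exact h
  have hqd : ∀ z, f z ≠ 0 → DifferentiableAt ℂ (fun z => g z / f z) z := fun z hz =>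
    (hg z).div (hf z) hz
  have hC0 : 0 ≤ C := by
    have := (norm_nonneg _).trans (hC t₀)
    exact nonneg_of_mul_nonneg_left this (norm_pos_iff.2 h0)
  have hqb : ∀ z, ‖g z / f z‖ ≤ C := by
    intro z
    rw [norm_div]
    exact div_le_of_le_mul₀ (norm_nonneg _) hC0 (hC z)
  -- `h` is the extension of `g / f` over the zeros of `f`.
  set h : ℂ → ℂ := fun c => limUnder (𝓝[≠] c) fun z => g z / f z with hh
  have hlim : ∀ c, Tendsto (fun z => g z / f z) (𝓝[≠] c) (𝓝 (h c)) := fun c =>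
    Complex.tendsto_limUnder_of_differentiable_on_punctured_nhds_of_bounded_under
      ((hne c).mono hqd) (isBoundedUnder_of ⟨C + C, fun z =>
        (norm_sub_le _ _).trans (add_le_add (hqb _) (hqb _))⟩)
  have heq : ∀ c, f c ≠ 0 → h c = g c / f c := fun c hc =>
    tendsto_nhds_unique (hlim c) ((hqd c hc).continuousAt.tendsto.mono_left nhdsWithin_le_nhds)
  have hhd : Differentiable ℂ h := by
    intro c
    refine (Complex.analyticAt_of_differentiable_on_punctured_nhds_of_continuousAt
      ?_ ?_).differentiableAt
    · filter_upwards [hne c] with z hz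
      refine (hqd z hz).congr_of_eventuallyEq ?_
      filter_upwards [hf.continuous.continuousAt.eventually_ne hz] with w hw using heq w hw
    · refine continuousAt_iff_punctured_nhds.2 ?_
      exact (hlim c).congr' ((hne c).mono fun z hz => (heq z hz).symm)
  have hhb : Bornology.IsBounded (range h) := by
    refine (isBounded_closedBall (x := (0 : ℂ)) (r := C)).subset ?_
    rintro _ ⟨c, rfl⟩
    rw [mem_closedBall_zero_iff]
    exact le_of_tendsto (hlim c).norm (Eventually.of_forall hqb)
  have hconst := hhd.apply_eq_apply_of_bounded hhb t t₀
  by_cases ht : f t = 0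
  · have : g t = 0 := by simpa [ht] using hC t
    simp [this, ht]
  · rw [heq t ht, heq t₀ h0, div_eq_div_iff ht h0] at hconst
    exact hconst

section Kernel
variable {E : Type*} [AddCommGroup E] {ι : Type*} [Fintype ι]

/-- A bound for `k` points holds for any smaller number of points: pad with zero weights. -/
lemma norm_sum_le_of_card_le {k : ℕ} {f : ι → E → ℂ} {g : E → ℂ} {C : ℝ}
    (h : ∀ (z : Fin k → E) (a : Fin k → ℂ),
      ‖∑ i, a i * g (z i)‖ ^ 2 ≤ C * ∑ l, ‖∑ i, a i * f l (z i)‖ ^ 2)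
    {κ : Type*} [Fintype κ] (hκ : Fintype.card κ ≤ k) (z : κ → E) (a : κ → ℂ) :
    ‖∑ i, a i * g (z i)‖ ^ 2 ≤ C * ∑ l, ‖∑ i, a i * f l (z i)‖ ^ 2 := by
  obtain ⟨e⟩ : Nonempty (κ ↪ Fin k) := Function.Embedding.nonempty_of_card_le (by simpa using hκ)
  have key : ∀ φ : E → ℂ, ∑ i, Function.extend e a 0 i * φ (Function.extend e z 0 i) =
      ∑ i, a i * φ (z i) := by
    intro φ
    symm
    refine Finset.sum_of_injOn e e.injective.injOn (by simp) (fun i _ hi => ?_) fun i _ => ?_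
    · rw [Function.extend_apply' _ _ _ (by simpa using hi)]
      simp
    · simp [e.injective.extend_apply]
  simpa only [key] using h (Function.extend e z 0) (Function.extend e a 0)

/-- There are finitely many points `p j` whose values under `F` form a basis of the span of the
range of `F`; the functionals `φ j` extend the coordinates of this basis. -/
lemma exists_dual_points {E V : Type*} [AddCommGroup V] [Module ℂ V] [FiniteDimensional ℂ V]
    (F : E → V) : ∃ r, r ≤ Module.finrank ℂ V ∧ ∃ (p : Fin r → E) (φ : Fin r → V →ₗ[ℂ] ℂ),
      (∀ i, φ i (F (p i)) = 1) ∧ ∀ z, F z = ∑ j, φ j (F z) • F (p j) := by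
  obtain ⟨w, hw, hspan, hli⟩ := Submodule.exists_fun_fin_finrank_span_eq ℂ (range F)
  choose p hp using hw
  obtain rfl : (fun i => F (p i)) = w := funext hp
  refine ⟨_, Submodule.finrank_le _, p, ?_⟩
  have hext := fun j => LinearMap.exists_extend ((Module.Basis.span hli).coord j)
  choose φ hφ using hext
  have hφ' : ∀ j (x : V) (hx : x ∈ Submodule.span ℂ (range fun i => F (p i))),
      φ j x = (Module.Basis.span hli).coord j ⟨x, hx⟩ := fun j x hx =>
    LinearMap.congr_fun (hφ j) ⟨x, hx⟩
  refine ⟨φ, fun i => ?_, fun z => ?_⟩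
  · rw [hφ' i _ (Submodule.subset_span ⟨i, rfl⟩)]
    have : (⟨F (p i), Submodule.subset_span ⟨i, rfl⟩⟩ :
        Submodule.span ℂ (range fun i => F (p i))) = Module.Basis.span hli i := by
      ext; simp [Module.Basis.span_apply]
    rw [this]; simp
  · have hz : F z ∈ Submodule.span ℂ (range fun i => F (p i)) := by
      rw [hspan]; exact Submodule.subset_span ⟨z, rfl⟩
    have := congrArg Subtype.val ((Module.Basis.span hli).sum_repr ⟨F z, hz⟩)
    simp only [AddSubmonoidClass.coe_finsetSum, Submodule.coe_smul, Module.Basis.span_apply] at this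
    refine this.symm.trans (Finset.sum_congr rfl fun j _ => ?_)
    rw [hφ' j _ hz]
    rfl

variable [Module ℂ E]

/-- If the kernel `C ∑ f_l(z) conj f_l(w) - g(z) conj g(w)` is positive on any `k ≥ 1` points and
there are at most `k` functions `f_l`, then `g` is a linear combination of them. Here `f_l` and `g` are
entire along complex lines, which is all that Liouville's theorem needs. -/
theorem exists_eq_sum_of_kernel_bound {k : ℕ} (hk : 1 ≤ k) (hι : Fintype.card ι ≤ k)
    {f : ι → E → ℂ} {g : E → ℂ}
    (hf : ∀ l p v, Differentiable ℂ fun t : ℂ => f l (p + t • v))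
    (hg : ∀ p v, Differentiable ℂ fun t : ℂ => g (p + t • v)) {C : ℝ}
    (h : ∀ (z : Fin k → E) (a : Fin k → ℂ),
      ‖∑ i, a i * g (z i)‖ ^ 2 ≤ C * ∑ l, ‖∑ i, a i * f l (z i)‖ ^ 2) :
    ∃ s : ι → ℂ, ∀ z, g z = ∑ l, s l * f l z := by
  classical
  obtain ⟨r, hr, p, φ, hφp, hφ⟩ := exists_dual_points (fun z l => f l z)
  rw [Module.finrank_fintype_fun_eq_card] at hr
  set b : Fin r → E → ℂ := fun j z => φ j fun l => f l z with hb
  have hbf : ∀ l z, f l z = ∑ j, b j z * f l (p j) := fun l z => by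
    simpa using congrFun (hφ z) l
  have hbs : ∀ j z, b j z = ∑ l, φ j (Pi.single l 1) * f l z := fun j z => by
    simp only [hb]
    conv_lhs => rw [LinearMap.pi_apply_eq_sum_univ (φ j)]
    refine Finset.sum_congr rfl fun l _ => ?_
    rw [smul_eq_mul, mul_comm]
    congr 2
    ext i; simp [Pi.single_apply, eq_comm]
  suffices ∃ κ : Fin r → ℂ, ∀ z, g z = ∑ j, κ j * b j z by
    obtain ⟨κ, hκ⟩ := this
    refine ⟨fun l => ∑ j, κ j * φ j (Pi.single l 1), fun z => ?_⟩
    rw [hκ]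
    simp_rw [hbs, Finset.mul_sum, Finset.sum_mul]
    rw [Finset.sum_comm]
    simp only [mul_assoc]
  rcases (hr.trans hι).lt_or_eq with hlt | rfl
  -- With a point to spare, `z` and all of the `p j` carry a relation that kills every `f l`.
  · refine ⟨fun j => g (p j), fun z => ?_⟩
    have h1 := norm_sum_le_of_card_le h (κ := Option (Fin r)) (by simpa using hlt)
      (fun o => o.elim z p) (fun o => o.elim 1 fun j => -b j z)
    simp only [Fintype.sum_option, Option.elim, one_mul, neg_mul, Finset.sum_neg_distrib,
      ← hbf, ← sub_eq_add_neg, sub_self] at h1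
    have h2 : g z - ∑ j, b j z * g (p j) = 0 := by simpa using h1
    rw [sub_eq_zero.1 h2]
    simp only [mul_comm]
  -- Otherwise `z` replaces `p 0`: the relation kills the `f l` up to a multiple of `b 0 z`, and
  -- Liouville's theorem applies on each complex line through `p 0`.
  · obtain ⟨r, rfl⟩ : ∃ r', r = r' + 1 := ⟨r - 1, by omega⟩
    set G : E → ℂ := fun z => g z - ∑ i : Fin r, b i.succ z * g (p i.succ) with hG
    have hbd : ∀ j p v, Differentiable ℂ fun t : ℂ => b j (p + t • v) := fun j p v => by
      simp only [hbs]
      exact Differentiable.fun_sum fun l _ => (hf l p v).const_mul _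
    have hGd : ∀ p v, Differentiable ℂ fun t : ℂ => G (p + t • v) := fun p v =>
      (hg p v).sub (Differentiable.fun_sum fun l _ => (hbd _ p v).mul_const _)
    set D : ℝ := C * ∑ l, ‖f l (p 0)‖ ^ 2 with hD
    have hle : ∀ z, ‖G z‖ ^ 2 ≤ D * ‖b 0 z‖ ^ 2 := by
      intro z
      have h1 := h (Fin.cons z fun i => p i.succ) (Fin.cons 1 fun i => -b i.succ z)
      simp only [Fin.sum_univ_succ, Fin.cons_zero, Fin.cons_succ, one_mul, neg_mul,
        Finset.sum_neg_distrib, ← sub_eq_add_neg] at h1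
      have h2 : ∀ l, f l z - ∑ i : Fin r, b i.succ z * f l (p i.succ) = b 0 z * f l (p 0) := by
        intro l
        rw [hbf l z, Fin.sum_univ_succ, add_sub_cancel_right]
      simp only [h2, norm_mul, mul_pow] at h1
      rw [← Finset.mul_sum] at h1
      refine h1.trans (le_of_eq ?_)
      rw [hD]; ring
    have hle' : ∀ z, ‖G z‖ ≤ Real.sqrt D * ‖b 0 z‖ := by
      intro z
      have := Real.sqrt_le_sqrt (hle z)
      rwa [Real.sqrt_sq (norm_nonneg _), Real.sqrt_mul' _ (sq_nonneg _),
        Real.sqrt_sq (norm_nonneg _)] at this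
    refine ⟨Fin.cons (G (p 0)) fun i => g (p i.succ), fun z => ?_⟩
    have h3 := mul_eq_mul_of_norm_le (hbd 0 (p 0) (z - p 0)) (hGd (p 0) (z - p 0))
      (fun t => hle' _) (t₀ := 0) (by simp [hb, hφp]) 1
    have h4 : b 0 (p 0) = 1 := hφp 0
    simp only [zero_smul, add_zero, one_smul, add_sub_cancel, h4, mul_one] at h3
    have h5 : g z = G z + ∑ i : Fin r, b i.succ z * g (p i.succ) := (sub_add_cancel _ _).symm
    rw [h5, h3, Fin.sum_univ_succ]
    simp only [Fin.cons_zero, Fin.cons_succ, mul_comm (b _ z)]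

end Kernel

/-! ### Compact symmetric operators and their positive eigenspaces -/

section Spectral
variable {H : Type*} [NormedAddCommGroup H] [InnerProductSpace ℂ H]

/-- A compact symmetric operator without positive eigenvalues is negative semidefinite, since its
nonzero spectrum consists of eigenvalues. -/
lemma re_inner_nonpos_of_compact [CompleteSpace H] {S : H →L[ℂ] H} (hS : IsCompactOperator S)
    (hS' : S.IsSymmetric)
    (h : ∀ μ : ℝ, 0 < μ → Module.End.eigenspace (S : Module.End ℂ H) (μ : ℂ) = ⊥) (y : H) :
    (⟪y, S y⟫_ℂ).re ≤ 0 := by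
  have hsa : IsSelfAdjoint S := hS'.isSelfAdjoint
  have h0 : 0 ≤ -S := by
    rw [StarOrderedRing.nonneg_iff_spectrum_nonneg (R := ℝ) _ hsa.neg]
    intro x hx
    by_contra hneg
    rw [not_le] at hneg
    rw [← spectrum.neg_eq, Set.mem_neg] at hx
    rw [← spectrum.algebraMap_mem_iff ℂ] at hx
    have hne : algebraMap ℝ ℂ (-x) ≠ 0 := by simpa using hneg.ne
    rw [← hS.hasEigenvalue_iff_mem_spectrum hne] at hx
    exact hx (h (-x) (by linarith))
  have h1 := ((ContinuousLinearMap.nonneg_iff_isPositive _).1 h0).re_inner_nonneg_right y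
  simpa using h1

/-- The sum of the eigenspaces of `T` for positive eigenvalues. -/
def posSpace (T : H →L[ℂ] H) : Submodule ℂ H :=
  ⨆ μ : Ioi (0 : ℝ), Module.End.eigenspace (T : Module.End ℂ H) ((μ : ℝ) : ℂ)

lemma apply_mem_posSpace {T : H →L[ℂ] H} {x : H} (hx : x ∈ posSpace T) : T x ∈ posSpace T := by
  have : posSpace T ≤ (posSpace T).comap (T : H →ₗ[ℂ] H) := by
    refine iSup_le fun μ y hy => ?_
    have hy' := Module.End.mem_eigenspace_iff.1 hy
    rw [Submodule.mem_comap, hy']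
    exact Submodule.smul_mem _ _ (Submodule.mem_iSup_of_mem μ hy)
  exact this hx

lemma posSpace_le_range (T : H →L[ℂ] H) : posSpace T ≤ LinearMap.range (T : H →ₗ[ℂ] H) := by
  refine iSup_le fun μ y hy => ?_
  have hy' : T y = ((μ : ℝ) : ℂ) • y := Module.End.mem_eigenspace_iff.1 hy
  have hμ : ((μ : ℝ) : ℂ) ≠ 0 := by exact_mod_cast (ne_of_gt μ.2)
  exact ⟨((μ : ℝ) : ℂ)⁻¹ • y, by
    change T (((μ : ℝ) : ℂ)⁻¹ • y) = y
    rw [map_smul, hy', smul_smul, inv_mul_cancel₀ hμ, one_smul]⟩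

lemma apply_mem_posSpace_orthogonal {T : H →L[ℂ] H} (hT : T.IsSymmetric) {y : H}
    (hy : y ∈ (posSpace T)ᗮ) : T y ∈ (posSpace T)ᗮ := by
  intro x hx
  exact (hT x y).symm.trans (hy _ (apply_mem_posSpace hx))

lemma re_inner_nonpos_of_mem_orthogonal [CompleteSpace H] {T : H →L[ℂ] H} (hT : IsCompactOperator T)
    (hT' : T.IsSymmetric) {y : H} (hy : y ∈ (posSpace T)ᗮ) : (⟪y, T y⟫_ℂ).re ≤ 0 := by
  have hinv : ∀ y ∈ (posSpace T)ᗮ, T y ∈ (posSpace T)ᗮ := fun y hy =>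
    apply_mem_posSpace_orthogonal hT' hy
  let S : (posSpace T)ᗮ →L[ℂ] (posSpace T)ᗮ := T.restrict hinv
  have hS : IsCompactOperator S := hT.restrict' hinv
  have hS' : S.IsSymmetric := hT'.restrict_invariant hinv
  refine re_inner_nonpos_of_compact hS hS' (fun μ hμ => ?_) ⟨y, hy⟩
  rw [Submodule.eq_bot_iff]
  intro x hx
  have hx' : S x = (μ : ℂ) • x := Module.End.mem_eigenspace_iff.1 hx
  have hx1 : T x = (μ : ℂ) • (x : H) := congrArg Subtype.val hx'
  have hx2 : (x : H) ∈ posSpace T :=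
    Submodule.mem_iSup_of_mem (⟨μ, hμ⟩ : Ioi (0 : ℝ)) (Module.End.mem_eigenspace_iff.2 hx1)
  have := x.2 _ hx2
  rw [inner_self_eq_zero] at this
  exact Subtype.ext this

lemma mem_posSpace_orthogonal_of_neg {T : H →L[ℂ] H} (hT : T.IsSymmetric) {u : H} {μ : ℝ}
    (hμ : μ < 0) (hu : T u = (μ : ℂ) • u) : u ∈ (posSpace T)ᗮ := by
  have : posSpace T ≤ (ℂ ∙ u)ᗮ := by
    refine iSup_le fun ν y hy => ?_
    have hy' : T y = ((ν : ℝ) : ℂ) • y := Module.End.mem_eigenspace_iff.1 hy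
    rw [Submodule.mem_orthogonal_singleton_iff_inner_right]
    have h : ⟪T u, y⟫_ℂ = ⟪u, T y⟫_ℂ := hT u y
    rw [hu, hy', inner_smul_left, inner_smul_right, Complex.conj_ofReal] at h
    have h2 : ((μ - (ν : ℝ) : ℝ) : ℂ) * ⟪u, y⟫_ℂ = 0 := by
      push_cast; linear_combination h
    refine (mul_eq_zero.1 h2).resolve_left ?_
    have := ν.2
    exact_mod_cast (by rw [mem_Ioi] at this; linarith : μ - (ν : ℝ) < 0).ne
  intro x hx
  exact (Submodule.mem_orthogonal_singleton_iff_inner_left.1 (this hx))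

/-- The form of a compact symmetric operator with a unit eigenvector `u` of negative eigenvalue `μ`
is bounded above by its part on the positive eigenspaces plus the contribution of `u`. -/
theorem re_inner_le [CompleteSpace H] {T : H →L[ℂ] H} (hT : IsCompactOperator T)
    (hT' : T.IsSymmetric) [FiniteDimensional ℂ (posSpace T)] {u : H} (hu1 : ‖u‖ = 1) {μ : ℝ} (hμ : μ < 0)
    (hu : T u = (μ : ℂ) • u) (x : H) :
    (⟪x, T x⟫_ℂ).re ≤
      ‖T‖ * ∑ l, ‖⟪(stdOrthonormalBasis ℂ (posSpace T) l : H), x⟫_ℂ‖ ^ 2 + μ * ‖⟪u, x⟫_ℂ‖ ^ 2 := by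
  set V := posSpace T with hV
  obtain ⟨p, hp, y, hy, rfl⟩ : ∃ p ∈ V, ∃ y ∈ Vᗮ, x = p + y :=
    V.exists_add_mem_mem_orthogonal x
  have huV : u ∈ Vᗮ := mem_posSpace_orthogonal_of_neg hT' hμ hu
  set s := ⟪u, y⟫_ℂ with hs
  set w := y - s • u with hw
  have hwV : w ∈ Vᗮ := Submodule.sub_mem _ hy (Submodule.smul_mem _ _ huV)
  have huu : ⟪u, u⟫_ℂ = 1 := by rw [inner_self_eq_norm_sq_to_K, hu1]; simp
  have huw : ⟪u, w⟫_ℂ = 0 := by rw [hw, inner_sub_right, inner_smul_right, huu, ← hs]; ring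
  have hwu : ⟪w, u⟫_ℂ = 0 := inner_eq_zero_symm.1 huw
  have hyw : y = w + s • u := by rw [hw]; abel
  have hup : ⟪u, p⟫_ℂ = 0 := inner_eq_zero_symm.1 (huV p hp)
  have hsum : ∑ l, ‖⟪(stdOrthonormalBasis ℂ V l : H), p + y⟫_ℂ‖ ^ 2 = ‖p‖ ^ 2 := by
    have h1 := (stdOrthonormalBasis ℂ V).sum_sq_norm_inner_right ⟨p, hp⟩
    refine Eq.trans (Finset.sum_congr rfl fun l _ => ?_) h1
    rw [inner_add_right, hy _ (stdOrthonormalBasis ℂ V l).2, add_zero]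
    rfl
  have huy : ⟪u, p + y⟫_ℂ = s := by rw [inner_add_right, hup, zero_add]
  have huTw : ⟪u, T w⟫_ℂ = 0 := by
    have : ⟪T u, w⟫_ℂ = ⟪u, T w⟫_ℂ := hT' u w
    rw [← this, hu, inner_smul_left, huw, mul_zero]
  have h1 : ⟪p + y, T (p + y)⟫_ℂ = ⟪p, T p⟫_ℂ + ⟪y, T y⟫_ℂ := by
    rw [map_add, inner_add_left, inner_add_right, inner_add_right,
      apply_mem_posSpace_orthogonal hT' hy p hp,
      inner_eq_zero_symm.1 (hy _ (apply_mem_posSpace hp))]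
    ring
  have h2 : ⟪y, T y⟫_ℂ = ⟪w, T w⟫_ℂ + ((μ * ‖s‖ ^ 2 : ℝ) : ℂ) := by
    rw [hyw, map_add, map_smul, hu, inner_add_left, inner_add_right, inner_add_right,
      inner_smul_left, inner_smul_left, inner_smul_right, inner_smul_right, inner_smul_right,
      inner_smul_right, huTw, hwu, huu]
    push_cast
    rw [← Complex.conj_mul']
    ring
  have h3 : (⟪p, T p⟫_ℂ).re ≤ ‖T‖ * ‖p‖ ^ 2 := by
    calc (⟪p, T p⟫_ℂ).re ≤ ‖p‖ * ‖T p‖ := re_inner_le_norm (𝕜 := ℂ) p (T p)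
      _ ≤ ‖p‖ * (‖T‖ * ‖p‖) := by gcongr; exact T.le_opNorm p
      _ = _ := by ring
  have h4 := re_inner_nonpos_of_mem_orthogonal hT hT' hwV
  rw [hsum, huy, h1, h2, Complex.add_re, Complex.add_re, Complex.ofReal_re]
  linarith

end Spectral

/-! ### Dimension of a sum of subspaces -/

section Rank

lemma toENat_rank_sup_le {K V S : Type*} [DivisionRing K] [AddCommGroup V] [Module K V]
    (W : S → Submodule K V) (F : Finset S) :
    Cardinal.toENat (Module.rank K (F.sup W : Submodule K V)) ≤
      ∑ μ ∈ F, Cardinal.toENat (Module.rank K (W μ)) := by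
  classical
  induction F using Finset.induction_on with
  | empty => simp
  | insert a F ha ih =>
    rw [Finset.sup_insert, Finset.sum_insert ha]
    calc _ ≤ Cardinal.toENat (Module.rank K (W a) + Module.rank K (F.sup W : Submodule K V)) :=
          OrderHomClass.mono _ (Submodule.rank_add_le_rank_add_rank _ _)
      _ ≤ _ := by rw [map_add]; gcongr

/-- A family of subspaces whose dimensions have all finite partial sums at most `k` spans a space of
dimension at most `k`. -/
lemma finrank_iSup_le_of_sum_le {K V S : Type*} [DivisionRing K] [AddCommGroup V] [Module K V]
    (W : S → Submodule K V) {k : ℕ}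
    (h : ∀ F : Finset S, ∑ μ ∈ F, Cardinal.toENat (Module.rank K (W μ)) ≤ k) :
    FiniteDimensional K (⨆ μ, W μ : Submodule K V) ∧
      Module.finrank K (⨆ μ, W μ : Submodule K V) ≤ k := by
  classical
  have h1 : ∀ F : Finset S, Module.rank K (F.sup W : Submodule K V) ≤ k := fun F =>
    Cardinal.toENat_le_natCast.1 ((toENat_rank_sup_le W F).trans (h F))
  have h2 : ∀ F : Finset S, FiniteDimensional K (F.sup W : Submodule K V) := fun F =>
    Module.rank_lt_aleph0_iff.1 ((h1 F).trans_lt (Cardinal.natCast_lt_aleph0))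
  have h3 : ∀ F : Finset S, Module.finrank K (F.sup W : Submodule K V) ≤ k := fun F =>
    Module.finrank_le_of_rank_le (h1 F)
  obtain ⟨F, hF⟩ : ∃ F : Finset S, ∀ F' : Finset S,
      Module.finrank K (F'.sup W : Submodule K V) ≤ Module.finrank K (F.sup W : Submodule K V) := by
    have hb : BddAbove (range fun F : Finset S => Module.finrank K (F.sup W : Submodule K V)) :=
      ⟨k, by rintro _ ⟨F, rfl⟩; exact h3 F⟩
    obtain ⟨F, hF⟩ := Nat.sSup_mem (range_nonempty _) hb
    exact ⟨F, fun F' => (le_csSup hb ⟨F', rfl⟩).trans hF.ge⟩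
  have h4 : (⨆ μ, W μ) = F.sup W := by
    refine le_antisymm (iSup_le fun μ => ?_) (Finset.sup_le fun μ _ => le_iSup W μ)
    have h5 : F.sup W ≤ (insert μ F).sup W := Finset.sup_mono (Finset.subset_insert _ _)
    -- The dimension of `F.sup W` is maximal, so adding `W μ` does not enlarge it.
    have := h2 (insert μ F)
    rw [Submodule.eq_of_le_of_finrank_le h5 (hF _)]
    exact Finset.le_sup (Finset.mem_insert_self _ _)
  rw [h4]
  exact ⟨h2 F, h3 F⟩

end Rank

/-! ### The operator of an absolutely summable matrix -/

local notation "ℓ²(" ι ")" => lp (fun _ : ι => ℂ) 2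

section MatrixOperator
variable {ι : Type}

open Classical in
/-- The operator on `ℓ²(ι)` of an absolutely summable matrix `c`, as a norm convergent sum of rank
one operators; the value is `0` if that sum diverges. -/
def matOp (c : ι → ι → ℂ) : ℓ²(ι) →L[ℂ] ℓ²(ι) :=
  ∑' p : ι × ι, c p.1 p.2 • InnerProductSpace.rankOne ℂ
    (lp.single 2 p.1 (1 : ℂ) : ℓ²(ι)) (lp.single 2 p.2 (1 : ℂ) : ℓ²(ι))

variable {c : ι → ι → ℂ}

open Classical in
lemma hasSum_matOp (hc : Summable fun p : ι × ι => c p.1 p.2) :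
    HasSum (fun p : ι × ι => c p.1 p.2 • InnerProductSpace.rankOne ℂ
      (lp.single 2 p.1 (1 : ℂ) : ℓ²(ι)) (lp.single 2 p.2 (1 : ℂ) : ℓ²(ι))) (matOp c) := by
  refine (Summable.of_norm_bounded hc.norm fun p => ?_).hasSum
  rw [norm_smul, InnerProductSpace.norm_rankOne, lp.norm_single (by norm_num),
    lp.norm_single (by norm_num)]
  simp

lemma hasSum_matOp_apply (hc : Summable fun p : ι × ι => c p.1 p.2) (v : ℓ²(ι)) (a : ι) :
    HasSum (fun b => c a b * v b) (matOp c v a) := by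
  classical
  have h1 := (ContinuousLinearMap.apply ℂ (ℓ²(ι)) v).hasSum (hasSum_matOp hc)
  have h2 := (innerSL ℂ (lp.single 2 a (1 : ℂ) : ℓ²(ι))).hasSum h1
  have h3 := ((Prod.mk_right_injective a).hasSum_iff (fun p hp => ?_)).2 h2
  · simpa [lp.inner_single_left, inner_smul_right, Function.comp_def] using h3
  · have hne : a ≠ p.1 := fun h => hp ⟨p.2, by rw [h]⟩
    simp [lp.inner_single_left, hne]

lemma isCompactOperator_matOp (hc : Summable fun p : ι × ι => c p.1 p.2) :
    IsCompactOperator (matOp c) := by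
  classical
  refine isCompactOperator_of_tendsto (hasSum_matOp hc) (Eventually.of_forall fun s => ?_)
  exact Submodule.sum_mem (compactOperator (RingHom.id ℂ) (ℓ²(ι)) (ℓ²(ι))) fun p _ =>
    Submodule.smul_mem _ _ ((isCompactOperator_of_locallyCompactSpace_dom (innerSL ℂ
      (lp.single 2 p.2 (1 : ℂ) : ℓ²(ι)))).clm_comp
        (ContinuousLinearMap.toSpanSingleton ℂ (lp.single 2 p.1 (1 : ℂ) : ℓ²(ι))))

lemma isSymmetric_matOp (hc : Summable fun p : ι × ι => c p.1 p.2)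
    (hh : ∀ a b, c b a = conj (c a b)) : (matOp c).IsSymmetric := by
  classical
  rw [← ContinuousLinearMap.isSelfAdjoint_iff_isSymmetric]
  have h1 := (hasSum_matOp hc).star
  have h2 := (Equiv.prodComm ι ι).hasSum_iff.2 (hasSum_matOp hc)
  refine h1.unique (h2.congr_fun fun p => ?_)
  simp [ContinuousLinearMap.star_eq_adjoint, hh p.1 p.2]

lemma eigenspace_eq_eigenspace_matOp (hc : Summable fun p : ι × ι => c p.1 p.2) (μ : ℝ) :
    eigenspace c μ = Module.End.eigenspace (matOp c : Module.End ℂ (ℓ²(ι))) (μ : ℂ) := by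
  ext v
  rw [Module.End.mem_eigenspace_iff]
  constructor
  · intro h
    ext a
    exact (hasSum_matOp_apply hc v a).unique (h a)
  · intro h a
    have h1 := hasSum_matOp_apply hc v a
    have h2 : matOp c v = (μ : ℂ) • v := h
    rw [h2] at h1
    exact h1

end MatrixOperator

/-! ### Entire functions given by power series -/

section PowerSeries

variable {n : ℕ}

lemma mono_le_mono {x y : Fin n → ℝ} (hx : ∀ i, 0 ≤ x i) (hxy : ∀ i, x i ≤ y i)
    (γ : Fin n → ℕ) : mono x γ ≤ mono y γ :=
  Finset.prod_le_prod (fun i _ => pow_nonneg (hx i) _) fun i _ => pow_le_pow_left₀ (hx i) (hxy i) _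

/-- The sum of the power series with coefficients `v`. -/
def seriesSum (v : (Fin n → ℕ) → ℂ) (z : Cn n) : ℂ := ∑' a, v a * mono z a

lemma differentiable_seriesSum_comp_line {v : (Fin n → ℕ) → ℂ}
    (hv : ∀ z, Summable fun a => v a * mono z a) (p w : Cn n) :
    Differentiable ℂ fun t : ℂ => seriesSum v (p + t • w) := by
  intro t₀
  set ρ : ℝ := ‖p‖ + (‖t₀‖ + 1) * ‖w‖ with hρ
  have hρ0 : 0 ≤ ρ := by positivity
  have hb : ∀ a, ∀ t ∈ ball (0 : ℂ) (‖t₀‖ + 1),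
      ‖v a * mono (p + t • w) a‖ ≤ ‖v a * mono (fun _ => (ρ : ℂ)) a‖ := by
    intro a t ht
    rw [mem_ball_zero_iff] at ht
    rw [norm_mul, norm_mul, norm_mono, norm_mono]
    refine mul_le_mul_of_nonneg_left (mono_le_mono (fun _ => norm_nonneg _) (fun i => ?_) a)
      (norm_nonneg _)
    rw [Complex.norm_of_nonneg hρ0]
    calc ‖(p + t • w) i‖ ≤ ‖p + t • w‖ := norm_le_pi_norm _ i
      _ ≤ ‖p‖ + ‖t‖ * ‖w‖ := (norm_add_le _ _).trans (by rw [norm_smul])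
      _ ≤ ρ := by rw [hρ]; gcongr
  have h := Complex.differentiableOn_tsum_of_summable_norm (hv fun _ => (ρ : ℂ)).norm
    (F := fun a t => v a * mono (p + t • w) a) (U := ball (0 : ℂ) (‖t₀‖ + 1))
    (fun a => by
      simp only [mono, Pi.add_apply, Pi.smul_apply]
      exact (by fun_prop : Differentiable ℂ _).differentiableOn) isOpen_ball hb
  exact h.differentiableAt (isOpen_ball.mem_nhds (by simp))

lemma star_mono (z : Cn n) (a : Fin n → ℕ) : mono (star z) a = conj (mono z a) := by
  simp [mono]

/-- A power series in two blocks of variables that vanishes identically has zero coefficients. -/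
lemma eq_zero_of_hasSum_mono_mono {d : (Fin n → ℕ) → (Fin n → ℕ) → ℂ}
    (h : ∀ z ζ : Cn n, HasSum (fun p : (Fin n → ℕ) × (Fin n → ℕ) =>
      d p.1 p.2 * (mono z p.1 * mono ζ p.2)) 0) : d = 0 := by
  have h1 : ∀ a (ζ : Cn n), Summable fun b => d a b * mono ζ b := by
    intro a ζ
    simpa [mono] using (h 1 ζ).summable.prod_factor a
  have h2 : ∀ ζ : Cn n, (fun a => ∑' b, d a b * mono ζ b) = 0 := by
    intro ζ
    refine eq_zero_of_hasSum_mono fun z => (h z ζ).prod_fiberwise fun a => ?_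
    refine ((h1 a ζ).hasSum.mul_right (mono z a)).congr_fun fun b => ?_
    ring
  funext a
  refine eq_zero_of_hasSum_mono fun ζ => ?_
  have h3 := (h1 a ζ).hasSum
  rwa [show ∑' b, d a b * mono ζ b = 0 from congrFun (h2 ζ) a] at h3

/-- The Taylor coefficients of a Hermitian symmetric function form a Hermitian matrix. -/
lemma taylorCoeff_symm {R : Cn n → Cn n → ℂ} (hR : IsHermitianSymmetric R) (a b : Fin n → ℕ) :
    taylorCoeff R b a = conj (taylorCoeff R a b) := by
  have h := eq_zero_of_hasSum_mono_mono
    (d := fun a b => taylorCoeff R a b - conj (taylorCoeff R b a)) fun z ζ => ?_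
  · exact sub_eq_zero.1 (congrFun (congrFun h b) a)
  · have h1 := hasSum_taylorCoeff hR.holomorphic z ζ
    have h2 := (Equiv.prodComm _ _).hasSum_iff.2
      (Complex.hasSum_conj'.2 (hasSum_taylorCoeff hR.holomorphic (star ζ) (star z)))
    rw [← hR.symm z (star ζ), star_star] at h2
    have h3 := h1.sub h2
    rw [sub_self] at h3
    refine h3.congr_fun fun p => ?_
    simp only [Function.comp, Equiv.prodComm_apply, Prod.fst_swap, Prod.snd_swap, map_mul,
      star_mono, Complex.conj_conj]
    ring

end PowerSeries

/-! ### From the coefficient operator to kernels -/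

section CoefficientOperator
variable {n : ℕ} {c : (Fin n → ℕ) → (Fin n → ℕ) → ℂ}

/-- Vectors in the range of the coefficient operator are coefficients of entire functions. -/
lemma summable_matOp_mul_mono
    (hc : ∀ z ζ : Cn n, Summable fun p : (Fin n → ℕ) × (Fin n → ℕ) =>
      c p.1 p.2 * (mono z p.1 * mono ζ p.2)) (v : ℓ²(Fin n → ℕ)) (z : Cn n) :
    Summable fun a => matOp c v a * mono z a := by
  have hc0 : Summable fun p : (Fin n → ℕ) × (Fin n → ℕ) => c p.1 p.2 := by
    simpa [mono] using hc 1 1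
  have h1 : Summable fun p : (Fin n → ℕ) × (Fin n → ℕ) => c p.1 p.2 * v p.2 * mono z p.1 := by
    refine Summable.of_norm_bounded ((hc z 1).norm.mul_right ‖v‖) fun p => ?_
    have := lp.norm_apply_le_norm (by norm_num) v p.2
    simp only [norm_mul, mono, Pi.one_apply, one_pow, Finset.prod_const_one, mul_one]
    calc _ = ‖c p.1 p.2‖ * ‖∏ i, z i ^ p.1 i‖ * ‖v p.2‖ := by ring
      _ ≤ _ := by gcongr
  obtain ⟨S, hS⟩ := h1
  exact (hS.prod_fiberwise fun a => (hasSum_matOp_apply hc0 v a).mul_right (mono z a)).summable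

open Classical in
/-- The vector of `ℓ²` with entries `x a` for `a ∈ s`, and `0` elsewhere. -/
def truncVec {ι : Type} (x : ι → ℂ) (s : Finset ι) : ℓ²(ι) := ∑ a ∈ s, lp.single 2 a (x a)

lemma inner_truncVec {ι : Type} (x : ι → ℂ) (s : Finset ι) (v : ℓ²(ι)) :
    ⟪v, truncVec x s⟫_ℂ = ∑ a ∈ s, x a * conj (v a) := by
  classical
  simp [truncVec, lp.inner_single_right]

lemma inner_truncVec_matOp {ι : Type} {c : ι → ι → ℂ} (hc : Summable fun p : ι × ι => c p.1 p.2)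
    (x : ι → ℂ) (s : Finset ι) :
    ⟪truncVec x s, matOp c (truncVec x s)⟫_ℂ =
      ∑ p ∈ s ×ˢ s, c p.1 p.2 * (conj (x p.1) * x p.2) := by
  classical
  have h1 : ∀ a b, matOp c (lp.single 2 b (x b)) a = c a b * x b := by
    intro a b
    refine (hasSum_matOp_apply hc _ a).unique ?_
    have := hasSum_single (f := fun b' => c a b' * (lp.single 2 b (x b) : ℓ²(ι)) b') b
      fun b' hb' => by simp [hb']
    simpa using this
  simp only [truncVec, map_sum, inner_sum, sum_inner, lp.inner_single_left, h1,
    Finset.sum_product]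
  rw [Finset.sum_comm]
  refine Finset.sum_congr rfl fun a _ => Finset.sum_congr rfl fun b _ => ?_
  simp
  ring

/-- Passing to the limit along finite truncations turns an inequality between quadratic forms on
`ℓ²` into one between kernels. -/
lemma kernel_bound {R : Cn n → Cn n → ℂ} {k : ℕ}
    (hR : ∀ z ζ, HasSum (fun p : (Fin n → ℕ) × (Fin n → ℕ) =>
      c p.1 p.2 * (mono z p.1 * mono ζ p.2)) (R z ζ))
    (hpos : ∀ (z : Fin k → Cn n) (a : Fin k → ℂ),
      0 ≤ ∑ i, ∑ j, R (z i) (star (z j)) * a i * conj (a j))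
    {κ : Type*} [Fintype κ] (v : κ → ℓ²(Fin n → ℕ)) (u : ℓ²(Fin n → ℕ)) {B μ : ℝ} (hμ : μ < 0)
    (hv : ∀ l z, Summable fun a => v l a * mono z a) (hu : ∀ z, Summable fun a => u a * mono z a)
    (hle : ∀ x, (⟪x, matOp c x⟫_ℂ).re ≤ B * ∑ l, ‖⟪v l, x⟫_ℂ‖ ^ 2 + μ * ‖⟪u, x⟫_ℂ‖ ^ 2)
    (z : Fin k → Cn n) (a : Fin k → ℂ) :
    ‖∑ i, a i * seriesSum u (z i)‖ ^ 2 ≤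
      (B / -μ) * ∑ l, ‖∑ i, a i * seriesSum (v l) (z i)‖ ^ 2 := by
  have hc0 : Summable fun p : (Fin n → ℕ) × (Fin n → ℕ) => c p.1 p.2 := by
    simpa [mono] using (hR 1 1).summable
  -- The coefficients of the conjugate of the evaluation functional `∑ i, a i δ_(z i)`.
  set x : (Fin n → ℕ) → ℂ := fun α => conj (∑ i, a i * mono (z i) α) with hx
  have hlin : ∀ w : ℓ²(Fin n → ℕ), (∀ z, Summable fun a => w a * mono z a) →
      Tendsto (fun s => ‖⟪w, truncVec x s⟫_ℂ‖ ^ 2) atTop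
        (𝓝 (‖∑ i, a i * seriesSum w (z i)‖ ^ 2)) := by
    intro w hw
    have h1 : HasSum (fun α => conj (x α * conj (w α))) (∑ i, a i * seriesSum w (z i)) := by
      refine (hasSum_sum fun i _ => ((hw (z i)).hasSum.mul_left (a i))).congr_fun fun α => ?_
      simp only [hx, map_mul, Complex.conj_conj, Finset.sum_mul]
      exact Finset.sum_congr rfl fun i _ => by ring
    have h2 : Tendsto (fun s => ∑ α ∈ s, conj (x α * conj (w α))) atTop
      (𝓝 (∑ i, a i * seriesSum w (z i))) := h1
    refine (h2.norm.pow 2).congr fun s => ?_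
    rw [inner_truncVec, ← map_sum, RCLike.norm_conj]
  have hquad : Tendsto (fun s => (⟪truncVec x s, matOp c (truncVec x s)⟫_ℂ).re) atTop
      (𝓝 (∑ i, ∑ j, R (z i) (star (z j)) * a i * conj (a j)).re) := by
    have h1 : HasSum (fun p : (Fin n → ℕ) × (Fin n → ℕ) => c p.1 p.2 * (conj (x p.1) * x p.2))
        (∑ i, ∑ j, R (z i) (star (z j)) * a i * conj (a j)) := by
      refine (hasSum_sum fun i _ => hasSum_sum fun j _ =>
        ((hR (z i) (star (z j))).mul_right (a i)).mul_right (conj (a j))).congr_fun fun p => ?_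
      simp only [hx, map_sum, map_mul, Complex.conj_conj, star_mono]
      rw [Finset.sum_mul_sum, Finset.mul_sum]
      simp_rw [Finset.mul_sum]
      exact Finset.sum_congr rfl fun i _ => Finset.sum_congr rfl fun j _ => by ring
    simp only [inner_truncVec_matOp hc0]
    have h2 : Tendsto (fun s : Finset ((Fin n → ℕ) × (Fin n → ℕ)) =>
      ∑ p ∈ s, c p.1 p.2 * (conj (x p.1) * x p.2)) atTop
        (𝓝 (∑ i, ∑ j, R (z i) (star (z j)) * a i * conj (a j))) := h1
    exact (Complex.continuous_re.tendsto _).comp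
      (h2.comp (tendsto_finsetProd_atTop.comp tendsto_atTop_diagonal))
  have hlim := le_of_tendsto_of_tendsto hquad
    (((tendsto_finsetSum _ fun l _ => hlin (v l) (hv l)).const_mul B).add
      ((hlin u hu).const_mul μ)) (Eventually.of_forall fun s => hle (truncVec x s))
  have h0 := (Complex.nonneg_iff.1 (hpos z a)).1
  rw [div_mul_eq_mul_div, le_div_iff₀ (by linarith)]
  linarith

theorem lt_npos_of_nneg_ne_zero {k : ℕ} (hk : 1 ≤ k) {R : Cn n → Cn n → ℂ}
    (hR : R ∈ posClass n k) (hneg : Nneg R ≠ 0) : (k : ℕ∞) < Npos R := by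
  by_contra! hle
  obtain ⟨hH, hpos⟩ := hR
  set c := taylorCoeff R with hcdef
  have hsum := hasSum_taylorCoeff hH.holomorphic
  have hc0 : Summable fun p : (Fin n → ℕ) × (Fin n → ℕ) => c p.1 p.2 := by
    simpa [mono] using (hsum 1 1).summable
  set T := matOp c with hT
  have hcomp : IsCompactOperator T := isCompactOperator_matOp hc0
  have hsymm : T.IsSymmetric := isSymmetric_matOp hc0 (taylorCoeff_symm hH)
  obtain ⟨μ, hμ, u, hu1, hu⟩ : ∃ μ : ℝ, μ < 0 ∧ ∃ u, ‖u‖ = 1 ∧ T u = (μ : ℂ) • u := by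
    by_contra hcon
    push Not at hcon
    refine hneg ?_
    simp only [Nneg, eigenvalueCount, ← bot_eq_zero', iSup_eq_bot]
    intro F
    refine Finset.sum_eq_zero fun μ _ => ?_
    have hbot : eigenspace c (μ : ℝ) = ⊥ := by
      rw [eigenspace_eq_eigenspace_matOp hc0, Submodule.eq_bot_iff]
      intro x hx
      by_contra hx0
      have hx' : T x = ((μ : ℝ) : ℂ) • x := Module.End.mem_eigenspace_iff.1 hx
      refine hcon μ μ.2 (((‖x‖⁻¹ : ℝ) : ℂ) • x) ?_ ?_
      · simp [norm_smul, hx0]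
      · rw [map_smul, hx', smul_comm]
    rw [eigenvalueMult, hbot]
    simp
  -- The positive eigenspaces span a space of dimension at most `k`.
  have hfin := finrank_iSup_le_of_sum_le (k := k)
    (fun μ : Ioi (0 : ℝ) => Module.End.eigenspace (T : Module.End ℂ (ℓ²(Fin n → ℕ))) ((μ : ℝ) : ℂ))
    fun F => by
      refine le_trans (le_of_eq (Finset.sum_congr rfl fun μ _ => ?_))
        ((le_iSup (fun F : Finset (Ioi (0 : ℝ)) => ∑ μ ∈ F, eigenvalueMult c (μ : ℝ)) F).trans hle)
      rw [eigenvalueMult, eigenspace_eq_eigenspace_matOp hc0]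
  obtain ⟨hfd, hdim⟩ : FiniteDimensional ℂ (posSpace T) ∧ Module.finrank ℂ (posSpace T) ≤ k := hfin
  set v : Fin (Module.finrank ℂ (posSpace T)) → ℓ²(Fin n → ℕ) :=
    fun l => (stdOrthonormalBasis ℂ (posSpace T) l : ℓ²(Fin n → ℕ)) with hv
  have hvs : ∀ l z, Summable fun a => v l a * mono z a := by
    intro l z
    obtain ⟨w, hw⟩ := posSpace_le_range T (stdOrthonormalBasis ℂ (posSpace T) l).2
    have := summable_matOp_mul_mono (fun z ζ => (hsum z ζ).summable) w z
    have hw' : matOp c w = v l := hw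
    rwa [← hcdef, hw'] at this
  have hus : ∀ z, Summable fun a => u a * mono z a := by
    intro z
    have := summable_matOp_mul_mono (fun z ζ => (hsum z ζ).summable) ((μ : ℂ)⁻¹ • u) z
    rwa [← hcdef, ← hT, map_smul, hu, smul_smul, inv_mul_cancel₀ (by exact_mod_cast hμ.ne),
      one_smul] at this
  have hbound := kernel_bound hsum hpos v u hμ hvs hus fun x => re_inner_le hcomp hsymm hu1 hμ hu x
  obtain ⟨s, hs⟩ := exists_eq_sum_of_kernel_bound hk (by simpa using hdim)
    (fun l p w => differentiable_seriesSum_comp_line (hvs l) p w)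
    (fun p w => differentiable_seriesSum_comp_line hus p w) hbound
  -- Comparing coefficients, `u` lies in the span of the positive eigenvectors, to which it is
  -- orthogonal.
  have hcoef : (fun a => u a - ∑ l, s l * v l a) = 0 := by
    refine eq_zero_of_hasSum_mono fun z => ?_
    have h1 := (hus z).hasSum.sub
      (hasSum_sum (s := Finset.univ) fun l _ => (hvs l z).hasSum.mul_left (s l))
    rw [show ∑' a, u a * mono z a = ∑ l, s l * ∑' a, v l a * mono z a from hs z, sub_self] at h1
    refine h1.congr_fun fun a => ?_
    rw [sub_mul, Finset.sum_mul]
    simp only [mul_assoc]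
  have huv : u = ∑ l, s l • v l := by
    ext a
    have h1 := sub_eq_zero.1 (congrFun hcoef a)
    rw [h1, lp.coeFn_sum]
    simp
  have humem : u ∈ posSpace T := by
    rw [huv]
    exact Submodule.sum_mem _ fun l _ => Submodule.smul_mem _ _ (stdOrthonormalBasis ℂ _ l).2
  have := mem_posSpace_orthogonal_of_neg hsymm hμ hu u humem
  rw [inner_self_eq_zero] at this
  simp [this] at hu1

end CoefficientOperator

end HermPos

end

theorem theorem1 (n k : ℕ) (hk : 1 ≤ k) (R : HermPos.Cn n → HermPos.Cn n → ℂ)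
    (hR : R ∈ HermPos.posClass n k) :
    HermPos.Nneg R = 0 ∨ (k : ℕ∞) + 1 ≤ HermPos.Npos R :=
  or_iff_not_imp_left.2 fun hneg =>
    Order.add_one_le_of_lt (HermPos.lt_npos_of_nneg_ne_zero hk hR hneg)
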